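/- Let $\mathbb F_q$ be a finite field with $q$ elements and let $K=\mathbb F_q((t^{-1}))$ be the field of formal Laurent series in $t^{-1}$, with its $t^{-1}$-adic topology. For a nonzero $f=\sum_{i\le n}a_it^i\in K$ with $a_n\neq 0$ put $\deg f=n$, and put $\deg 0=-\infty$; let $[f]=\sum_{0\le i\le n}a_it^i$ be the polynomial part of $f$. Let $\mathcal O=\{f\in K:\deg f\le 0\}$, $\mathbb L=\{f\in K:\deg f<0\}$ and $\mathbb J_0=\{f\in K:\deg f=0\}$, and let $\mu$ be the Haar measure of $(K,+)$ normalized by $\mu(\mathcal O)=1$. For $h\in\mathbb L$ with $\deg h=-1$, the algebraic Farey map $F_h$ is defined on $\mathcal O$ by $$F_h(f)=\begin{cases}\dfrac{f}{1-[(1-h)f^{-1}]f}, & \deg f\le -1,\\[2mm] \dfrac{1-[(1-h)f^{-1}]f}{f}, & \deg f=0,\end{cases}$$ with $F_h(0)=0$. Define a measure $\mu_A$ on $\mathcal O$ by $$\mu_A(D)=\frac{q^2}{2q-1}\,\mu(D\cap\mathbb L)+\frac{q}{2q-1}\,\mu(D\cap\mathbb J_0)\qquad\text{for Borel sets } D\subset\mathcal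 O.$$ Then, for every $h\in\mathbb L$ with $\deg h=-1$: the map $F_h$ sends $\mathcal O$ into $\mathcal O$; $\mu_A$ is a probability measure; and $\mu_A$ is $F_h$-invariant and ergodic. Moreover, for every $f\in\mathbb L\setminus\{0\}$, iterating $F_h$ exactly $1-\deg f$ times gives the Artin map: $F_h^{\,1-\deg f}(f)=\Psi(f)$, where $\Psi(f)=\frac1f-\left[\frac1f\right]$. -/

import Mathlib

open MeasureTheory
open scoped ENNReal LaurentSeries

namespace FareyMap

noncomputable section

/-! Throughout, `F` is a finite field with `q` elements, and the field `K = F((t⁻¹))` is Mathlib's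
field `F⸨X⸩` of formal Laurent series in the variable `X = t⁻¹`; so the coefficient of `t ^ i`
in `f` is `f.coeff (-i)`. Its topology is the `X`-adic (that is, `t⁻¹`-adic) one. -/

/-- The degree in `t`: the largest `i` with nonzero coefficient of `t ^ i`; `deg 0 = -∞`. -/
def deg {F : Type*} [Field F] (f : F⸨X⸩) : WithBot ℤ :=
  open Classical in if f = 0 then ⊥ else ((-f.order : ℤ) : WithBot ℤ)

/-- The integral part `[f]`: the part of `f` that is polynomial in `t`, consisting of the terms
`t ^ i` with `i ≥ 0`, that is, of the terms `X ^ n` with `n < 1`. -/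
def intPart {F : Type*} [Field F] (f : F⸨X⸩) : F⸨X⸩ :=
  HahnSeries.truncLT (1 : ℤ) f

/-- `𝒪 = {f : |f| ≤ 1}`. -/
def integers (F : Type*) [Field F] : Set F⸨X⸩ := {f | deg f ≤ 0}

/-- `𝕃 = {f : |f| < 1}`. -/
def maxIdeal (F : Type*) [Field F] : Set F⸨X⸩ := {f | deg f < 0}

/-- `𝕁ₙ = {f ∈ 𝒪 : deg f = -n}`. -/
def sphere (F : Type*) [Field F] (n : ℕ) : Set F⸨X⸩ :=
  {f | f ∈ integers F ∧ deg f = ((-(n : ℤ) : ℤ) : WithBot ℤ)}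

/-- The Artin map `f ↦ {1/f} = 1/f - [1/f]`, to be used on `𝕃 \ {0}`. -/
def artinMap {F : Type*} [Field F] (f : F⸨X⸩) : F⸨X⸩ :=
  1 / f - intPart (1 / f)

/-- The algebraic Farey map `F_h`, to be used on `𝒪`. (With `0⁻¹ = 0` it sends `0` to `0`.) -/
def fareyMap {F : Type*} [Field F] (h f : F⸨X⸩) : F⸨X⸩ :=
  open Classical in
  if deg f ≤ ((-1 : ℤ) : WithBot ℤ) then f / (1 - intPart ((1 - h) * f⁻¹) * f)
  else (1 - intPart ((1 - h) * f⁻¹) * f) / f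

/-- The Borel σ-algebra of `K`. -/
instance instMeasurableSpaceLaurent (F : Type*) [Field F] : MeasurableSpace F⸨X⸩ := borel _

instance instBorelSpaceLaurent (F : Type*) [Field F] : BorelSpace F⸨X⸩ := ⟨rfl⟩

theorem mem_integers_iff {F : Type*} [Field F] (f : F⸨X⸩) :
    f ∈ integers F ↔ ∀ n : ℤ, n < 0 → f.coeff n = 0 := by
  classical
  unfold integers deg
  by_cases hf : f = 0
  · simp [hf]
  · simp only [Set.mem_ofPred_eq, if_neg hf]
    rw [show (0 : WithBot ℤ) = ((0 : ℤ) : WithBot ℤ) from rfl, WithBot.coe_le_coe]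
    constructor
    · intro h n hn
      exact HahnSeries.coeff_eq_zero_of_lt_order (by omega)
    · intro h
      by_contra hlt
      exact HahnSeries.coeff_order_eq_zero.not.mpr hf (h f.order (by omega))

theorem integers_eq {F : Type*} [Field F] :
    integers F = ((Valued.v (R := F⸨X⸩)).integer : Set F⸨X⸩) := by
  ext f
  rw [mem_integers_iff, SetLike.mem_coe, Valuation.mem_integer_iff,
    LaurentSeries.valuation_le_iff_coeff_lt_log_eq_zero F one_ne_zero]
  simp

theorem isOpen_integers (F : Type*) [Field F] : IsOpen (integers F) := by
  rw [integers_eq]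
  exact Valued.isOpen_integer _

theorem isCompact_integers (F : Type*) [Field F] [Finite F] : IsCompact (integers F) := by
  let _ : TopologicalSpace F := ⊥
  have : DiscreteTopology F := ⟨rfl⟩
  let φ : (ℕ → F) → F⸨X⸩ := fun a => HahnSeries.ofPowerSeries ℤ F (PowerSeries.mk a)
  have hφ : ∀ (a : ℕ → F) (n : ℤ), (φ a).coeff n = if n < 0 then 0 else a n.natAbs := by
    intro a n
    simp [φ, PowerSeries.coeff_coe]
  have hcont : Continuous φ := by
    rw [continuous_iff_continuousAt]
    intro a U hU
    obtain ⟨γ, hγ⟩ := Valued.mem_nhds.mp hU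
    set g : WithZero (Multiplicative ℤ) := MonoidWithZeroHom.ValueGroup₀.embedding γ.1 with hg
    have hg0 : g ≠ 0 := by simp [hg]
    set D : ℤ := -(WithZero.log g - 1) with hD₀
    have hD : WithZero.exp (-D) < g := by
      rw [← WithZero.lt_log_iff_exp_lt hg0, hD₀]
      simp
    have hopen : {b : ℕ → F | ∀ n ∈ Finset.range D.toNat, b n = a n} ∈ nhds a := by
      have := set_pi_mem_nhds (Finset.finite_toSet (Finset.range D.toNat)) (x := a)
        (s := fun n => {a n}) (fun n _ => by simp)
      refine Filter.mem_of_superset this ?_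
      intro b hb n hn
      exact hb n hn
    refine Filter.mem_map.mpr (Filter.mem_of_superset hopen ?_)
    intro b hb
    apply hγ
    show Valued.v.restrict (φ b - φ a) < γ.1
    rw [Valued.v.restrict_lt_iff_lt_embedding]
    refine lt_of_le_of_lt ((LaurentSeries.valuation_le_iff_coeff_lt_eq_zero F).mpr ?_) hD
    intro n hn
    rw [HahnSeries.coeff_sub, hφ, hφ]
    split_ifs with h0
    · simp
    · rw [hb n.natAbs (Finset.mem_range.mpr (by omega)), sub_self]
  have hrange : integers F = Set.range φ := by
    ext f
    rw [mem_integers_iff]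
    constructor
    · intro h
      refine ⟨fun n => f.coeff n, ?_⟩
      ext n
      rw [hφ]
      split_ifs with h0
      · exact (h n h0).symm
      · congr 1; omega
    · rintro ⟨a, rfl⟩ n hn
      rw [hφ, if_pos hn]
  rw [hrange]
  exact isCompact_range hcont

/-- `𝒪` as a compact set with nonempty interior. -/
def compactIntegers (F : Type*) [Field F] [Finite F] : TopologicalSpace.PositiveCompacts F⸨X⸩ where
  carrier := integers F
  isCompact' := isCompact_integers F
  interior_nonempty' := by
    rw [(isOpen_integers F).interior_eq]
    exact ⟨0, by simp [mem_integers_iff]⟩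

/-- The Haar measure `μ` of the additive group of `K`, normalized by `μ(𝒪) = 1`. -/
def haar (F : Type*) [Field F] [Finite F] : Measure F⸨X⸩ :=
  Measure.addHaarMeasure (compactIntegers F)

/-- The measure `μ_A` on (the Borel sets of) `𝒪`:
`μ_A(D) = q² / (2q - 1) · μ(D ∩ 𝕃) + q / (2q - 1) · μ(D ∩ 𝕁₀)`. -/
def muA (F : Type*) [Field F] [Finite F] : Measure (integers F) :=
  Measure.comap Subtype.val
    (ENNReal.ofReal ((Nat.card F : ℝ) ^ 2 / (2 * (Nat.card F : ℝ) - 1)) •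
        (haar F).restrict (maxIdeal F) +
      ENNReal.ofReal ((Nat.card F : ℝ) / (2 * (Nat.card F : ℝ) - 1)) •
        (haar F).restrict (sphere F 0))

end

end FareyMap

/-!
Write `f ∈ 𝒪 \ {0}` as `f = 1 / (P + ψ)`, where `P = [1 / f]` is a nonzero polynomial and
`ψ = Ψ f ∈ 𝕃`. In these coordinates the Farey map is `(P, ψ) ↦ ([h P], ψ)` if `deg P ≥ 1`, and
it returns `ψ` if `P` is constant (`fareyMap_branch`, `fareyMap_branch_of_order_eq_zero`). As
`deg h = -1`, the operation `P ↦ [h P]` lowers the degree by exactly one, so that `ψ` is reached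
after `1 + deg P` steps; this is the statement about the Artin map.

For the measure, the branch `ψ ↦ 1 / (P + ψ)` scales all distances in `𝕃` by `q ^ (-2 deg P)`, hence
Haar measure as well (`haar_restrict_cell`). Summing over `P` and using that `P ↦ [h P]` is
`q`-to-one onto the nonzero polynomials (`bijective_shift_coeff`), the image under the Farey map of
Haar measure on `𝕃` is `q⁻¹` times Haar measure on `𝒪`, and the image of Haar measure on `𝕁₀` is
`q - 1` times Haar measure on `𝕃`. The combination `q μ|𝕃 + μ|𝕁₀` is therefore invariant, and `μ_A`
is its normalization.

For ergodicity, an invariant set `A` satisfies `1 / (P + ψ) ∈ A ↔ ψ ∈ A` for all `P`. Hence both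
`μ|𝕃` and its restriction to `A` are stationary for the iterated function system that chooses the
branch of `P` with probability `q ^ (-2 deg P)`. The branches are uniform contractions, so a
stationary measure is determined by its total mass (`IsStationary.smul_eq_smul`), the two measures
are proportional, and `A` is null or conull in `𝕃`. The branches of constant `P` carry this over to
`𝕁₀`.
-/

namespace FareyMap

/-! ### The filtration of the Laurent series field and integral parts -/

/-- The additive subgroup `X ^ m F⟦X⟧`, that is, `{f : deg f ≤ -m}`. Its cosets are the balls of
`F⸨X⸩`; it is `𝒪` for `m = 0` and `𝕃` for `m = 1`. -/
def tail (F : Type*) [Field F] (m : ℤ) : AddSubgroup F⸨X⸩ where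
  carrier := {f | ∀ n < m, f.coeff n = 0}
  zero_mem' := by simp
  add_mem' := fun ha hb n hn => by simp [ha n hn, hb n hn]
  neg_mem' := fun ha n hn => by simp [ha n hn]

section Algebra

variable {F : Type*} [Field F]

theorem mem_tail {m : ℤ} {f : F⸨X⸩} : f ∈ tail F m ↔ ∀ n < m, f.coeff n = 0 := Iff.rfl

theorem mem_tail_iff_order {m : ℤ} {f : F⸨X⸩} (hf : f ≠ 0) : f ∈ tail F m ↔ m ≤ f.order :=
  (HahnSeries.le_order_iff_forall hf).symm

theorem tail_anti {m n : ℤ} (h : m ≤ n) : tail F n ≤ tail F m :=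
  fun _ hf k hk => hf k (hk.trans_le h)

theorem mul_mem_tail {m n : ℤ} {f g : F⸨X⸩} (hf : f ∈ tail F m) (hg : g ∈ tail F n) :
    f * g ∈ tail F (m + n) := by
  by_cases hf0 : f = 0
  · simp [hf0, zero_mem]
  by_cases hg0 : g = 0
  · simp [hg0, zero_mem]
  rw [mem_tail_iff_order hf0] at hf
  rw [mem_tail_iff_order hg0] at hg
  rw [mem_tail_iff_order (mul_ne_zero hf0 hg0), HahnSeries.order_mul hf0 hg0]
  omega

theorem order_inv {f : F⸨X⸩} (hf : f ≠ 0) : (f⁻¹).order = -f.order := by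
  have h := HahnSeries.order_mul hf (inv_ne_zero hf)
  rw [mul_inv_cancel₀ hf, HahnSeries.order_one] at h
  omega

/-- A perturbation of higher order changes neither the order nor the nonvanishing. -/
theorem order_add {f e : F⸨X⸩} (hf : f ≠ 0) (he : e ∈ tail F (f.order + 1)) :
    f + e ≠ 0 ∧ (f + e).order = f.order := by
  have hc : (f + e).coeff f.order ≠ 0 := by
    rw [HahnSeries.coeff_add, he _ (by omega), add_zero]
    exact HahnSeries.coeff_order_eq_zero.not.mpr hf
  have h0 : f + e ≠ 0 := by
    rintro h
    simp [h] at hc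
  refine ⟨h0, le_antisymm (HahnSeries.order_le_of_coeff_ne_zero hc) ?_⟩
  rw [← mem_tail_iff_order h0]
  exact add_mem ((mem_tail_iff_order hf).2 le_rfl) (tail_anti (by omega) he)

/-- Inversion dilates distances on the sphere of order `n` by the constant factor `q ^ (2 * n)`. -/
theorem inv_sub_inv_mem_tail_iff {f g : F⸨X⸩} (hf : f ≠ 0) (hg : g ≠ 0) (hfg : f.order = g.order)
    {m : ℤ} : f⁻¹ - g⁻¹ ∈ tail F m ↔ f - g ∈ tail F (m + 2 * f.order) := by
  by_cases h : f = g
  · simp [h, zero_mem]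
  have h1 : f - g ≠ 0 := sub_ne_zero.2 h
  have h2 : f⁻¹ - g⁻¹ ≠ 0 := sub_ne_zero.2 fun e => h (inv_injective e)
  have e : f - g = -((f⁻¹ - g⁻¹) * (f * g)) := by field_simp; ring
  rw [mem_tail_iff_order h1, mem_tail_iff_order h2, e, HahnSeries.order_neg,
    HahnSeries.order_mul h2 (mul_ne_zero hf hg), HahnSeries.order_mul hf hg]
  omega

theorem deg_eq_coe_iff {f : F⸨X⸩} {d : ℤ} :
    deg f = (d : WithBot ℤ) ↔ f ≠ 0 ∧ f.order = -d := by
  unfold deg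
  split_ifs with h
  · simp [h]
  · rw [WithBot.coe_inj]
    simp only [ne_eq, h, not_false_eq_true, true_and]
    omega

theorem deg_le_coe_iff {f : F⸨X⸩} {d : ℤ} : deg f ≤ (d : WithBot ℤ) ↔ f ∈ tail F (-d) := by
  by_cases h : f = 0
  · simp [h, deg, zero_mem]
  · rw [mem_tail_iff_order h, deg, if_neg h, WithBot.coe_le_coe]
    omega

theorem integers_eq_tail : integers F = tail F 0 := by
  ext f
  exact deg_le_coe_iff (d := 0)

theorem maxIdeal_eq_tail : maxIdeal F = tail F 1 := by
  ext f
  by_cases h : f = 0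
  · simp [h, maxIdeal, deg, zero_mem]
  · rw [SetLike.mem_coe, mem_tail_iff_order h]
    show deg f < ((0 : ℤ) : WithBot ℤ) ↔ _
    rw [deg, if_neg h, WithBot.coe_lt_coe]
    omega

theorem mem_sphere_zero_iff {f : F⸨X⸩} : f ∈ sphere F 0 ↔ f ≠ 0 ∧ f.order = 0 := by
  unfold sphere
  rw [Set.mem_ofPred_eq, deg_eq_coe_iff, integers_eq_tail]
  constructor
  · rintro ⟨-, h, h'⟩
    exact ⟨h, by simpa using h'⟩
  · rintro ⟨h, h'⟩
    exact ⟨(mem_tail_iff_order h).2 h'.ge, h, by simpa using h'⟩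

@[simp]
theorem coeff_intPart (f : F⸨X⸩) (n : ℤ) :
    (intPart f).coeff n = if n < 1 then f.coeff n else 0 := rfl

theorem intPart_add (f g : F⸨X⸩) : intPart (f + g) = intPart f + intPart g :=
  HahnSeries.truncLT_add _ _ _

theorem intPart_sub (f g : F⸨X⸩) : intPart (f - g) = intPart f - intPart g := by
  rw [eq_sub_iff_add_eq, ← intPart_add, sub_add_cancel]

@[simp]
theorem intPart_intPart (f : F⸨X⸩) : intPart (intPart f) = intPart f := by
  ext n
  simp only [coeff_intPart]
  split_ifs <;> rfl

theorem intPart_eq_zero_iff {f : F⸨X⸩} : intPart f = 0 ↔ f ∈ tail F 1 := by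
  rw [mem_tail]
  constructor
  · intro h n hn
    have := congrArg (fun g => HahnSeries.coeff g n) h
    simpa [hn] using this
  · intro h
    ext n
    rw [coeff_intPart]
    split_ifs with hn
    · exact h n hn
    · rfl

theorem sub_intPart_mem (f : F⸨X⸩) : f - intPart f ∈ tail F 1 := by
  rw [← intPart_eq_zero_iff, intPart_sub, intPart_intPart, sub_self]

theorem intPart_eq_intPart_iff {f g : F⸨X⸩} : intPart f = intPart g ↔ f - g ∈ tail F 1 := by
  rw [← intPart_eq_zero_iff, intPart_sub, sub_eq_zero]

/-- A nonzero integral part has the order of the series. -/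
theorem order_intPart {f : F⸨X⸩} (hf : intPart f ≠ 0) :
    f ≠ 0 ∧ (intPart f).order = f.order ∧ f.order ≤ 0 := by
  have hf0 : f ≠ 0 := by
    rintro rfl
    exact hf (intPart_eq_zero_iff.2 (zero_mem _))
  have hle : f.order ≤ 0 := by
    by_contra h
    exact hf (intPart_eq_zero_iff.2 ((mem_tail_iff_order hf0).2 (by omega)))
  have := order_add hf0 (e := -(f - intPart f))
    (neg_mem (tail_anti (by omega) (sub_intPart_mem f)))
  rw [show f + -(f - intPart f) = intPart f by ring] at this
  exact ⟨hf0, this.2, hle⟩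

/-! ### Polynomials and the inverse branches of the Artin map -/

variable (F) in
/-- The nonzero polynomials in `t`: the nonzero series that agree with their integral part. -/
abbrev Poly : Type _ := {P : F⸨X⸩ // intPart P = P ∧ P ≠ 0}

namespace Poly

theorem order_nonpos (P : Poly F) : P.1.order ≤ 0 := by
  have h : intPart P.1 ≠ 0 := by rw [P.2.1]; exact P.2.2
  exact (order_intPart h).2.2

end Poly

/-- The inverse branch `ψ ↦ 1 / (P + ψ)` of the Artin map, to be used on `𝕃`. -/
noncomputable def branch (P : Poly F) (ψ : F⸨X⸩) : F⸨X⸩ := (P.1 + ψ)⁻¹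

theorem add_of_mem_tail (P : Poly F) {ψ : F⸨X⸩} (hψ : ψ ∈ tail F 1) :
    P.1 + ψ ≠ 0 ∧ (P.1 + ψ).order = P.1.order :=
  order_add P.2.2 (tail_anti (by have := P.order_nonpos; omega) hψ)

theorem branch_ne_zero (P : Poly F) {ψ : F⸨X⸩} (hψ : ψ ∈ tail F 1) : branch P ψ ≠ 0 :=
  inv_ne_zero (add_of_mem_tail P hψ).1

theorem order_branch (P : Poly F) {ψ : F⸨X⸩} (hψ : ψ ∈ tail F 1) :
    (branch P ψ).order = -P.1.order := by
  rw [branch, order_inv (add_of_mem_tail P hψ).1, (add_of_mem_tail P hψ).2]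

theorem branch_mem_tail (P : Poly F) {ψ : F⸨X⸩} (hψ : ψ ∈ tail F 1) :
    branch P ψ ∈ tail F (-P.1.order) := by
  rw [mem_tail_iff_order (branch_ne_zero P hψ), order_branch P hψ]

theorem intPart_add_of_mem_tail (P : Poly F) {ψ : F⸨X⸩} (hψ : ψ ∈ tail F 1) :
    intPart (P.1 + ψ) = P.1 := by
  rw [intPart_add, P.2.1, intPart_eq_zero_iff.2 hψ, add_zero]

theorem branch_sub_branch_mem_tail_iff (P : Poly F) {ψ φ : F⸨X⸩} (hψ : ψ ∈ tail F 1)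
    (hφ : φ ∈ tail F 1) {m : ℤ} :
    branch P ψ - branch P φ ∈ tail F m ↔ ψ - φ ∈ tail F (m + 2 * P.1.order) := by
  obtain ⟨h1, h2⟩ := add_of_mem_tail P hψ
  obtain ⟨h3, h4⟩ := add_of_mem_tail P hφ
  rw [branch, branch, inv_sub_inv_mem_tail_iff h1 h3 (h2.trans h4.symm), h2,
    add_sub_add_left_eq_sub]

/-- The image of `𝕃` under the branch of `P`, described as a fibre of `f ↦ [1 / f]`.
The convention `0⁻¹ = 0` keeps `0` out of every cell, as `P ≠ 0`. -/
def cell (P : Poly F) : Set F⸨X⸩ := {f | intPart f⁻¹ = P.1}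

theorem branch_mem_cell (P : Poly F) {ψ : F⸨X⸩} (hψ : ψ ∈ tail F 1) : branch P ψ ∈ cell P := by
  show intPart (branch P ψ)⁻¹ = P.1
  rw [branch, inv_inv, intPart_add_of_mem_tail P hψ]

theorem exists_branch_eq_of_mem_cell {P : Poly F} {f : F⸨X⸩} (hf : f ∈ cell P) :
    ∃ ψ ∈ tail F 1, branch P ψ = f :=
  ⟨f⁻¹ - P.1, by rw [← (hf : intPart f⁻¹ = P.1)]; exact sub_intPart_mem _, by simp [branch]⟩

/-- The cell of `P` is a ball of radius `q ^ (2 * order P - 1)`. -/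
theorem mem_cell_iff (P : Poly F) {ψ : F⸨X⸩} (hψ : ψ ∈ tail F 1) {f : F⸨X⸩} :
    f ∈ cell P ↔ f - branch P ψ ∈ tail F (1 - 2 * P.1.order) := by
  have hn := P.order_nonpos
  constructor
  · intro hf
    obtain ⟨φ, hφ, rfl⟩ := exists_branch_eq_of_mem_cell hf
    rw [branch_sub_branch_mem_tail_iff P hφ hψ]
    exact tail_anti (by omega) (sub_mem hφ hψ)
  · intro hf
    have h0 := branch_ne_zero P hψ
    have ho := order_branch P hψ
    obtain ⟨h1, h2⟩ := order_add h0 (tail_anti (by omega) hf)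
    rw [add_sub_cancel] at h1 h2
    have := (inv_sub_inv_mem_tail_iff h1 h0 h2 (m := 1)).2 (tail_anti (by omega) hf)
    rw [← intPart_eq_intPart_iff] at this
    exact this.trans (branch_mem_cell P hψ)

theorem exists_mem_cell_iff {f : F⸨X⸩} : (∃ P : Poly F, f ∈ cell P) ↔ f ≠ 0 ∧ f ∈ tail F 0 := by
  constructor
  · rintro ⟨P, hf⟩
    obtain ⟨ψ, hψ, rfl⟩ := exists_branch_eq_of_mem_cell hf
    exact ⟨branch_ne_zero P hψ, tail_anti (by have := P.order_nonpos; omega)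
      (branch_mem_tail P hψ)⟩
  · rintro ⟨h0, hf⟩
    refine ⟨⟨intPart f⁻¹, intPart_intPart _, ?_⟩, rfl⟩
    rw [Ne, intPart_eq_zero_iff, mem_tail_iff_order (inv_ne_zero h0), order_inv h0]
    rw [mem_tail_iff_order h0] at hf
    omega

/-! ### The Farey map on the cells -/

section Farey

variable {h : F⸨X⸩}

/-- For `deg h = -1` the operation `P ↦ [h P]` lowers the degree of a polynomial by one. -/
theorem intPart_mul_spec (h0 : h ≠ 0) (ho : h.order = 1) {P : F⸨X⸩} (hP0 : P ≠ 0)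
    (hneg : P.order ≤ -1) : intPart (h * P) ≠ 0 ∧ (intPart (h * P)).order = P.order + 1 := by
  have hm := HahnSeries.order_mul h0 hP0
  have : intPart (h * P) ≠ 0 := by
    rw [Ne, intPart_eq_zero_iff, mem_tail_iff_order (mul_ne_zero h0 hP0)]
    omega
  refine ⟨this, ?_⟩
  rw [(order_intPart this).2.1, hm]
  omega

/-- The polynomial `[h P]`, for `P` of degree at least `1`. -/
noncomputable def Poly.shift (h0 : h ≠ 0) (ho : h.order = 1) (P : Poly F) (hP : P.1.order ≤ -1) :
    Poly F :=
  ⟨intPart (h * P.1), intPart_intPart _, (intPart_mul_spec h0 ho P.2.2 hP).1⟩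

theorem Poly.order_shift (h0 : h ≠ 0) (ho : h.order = 1) (P : Poly F) (hP : P.1.order ≤ -1) :
    (P.shift h0 ho hP).1.order = P.1.order + 1 :=
  (intPart_mul_spec h0 ho P.2.2 hP).2

theorem intPart_one_sub_mul (h0 : h ≠ 0) (ho : h.order = 1) (P : Poly F) {ψ : F⸨X⸩}
    (hψ : ψ ∈ tail F 1) : intPart ((1 - h) * (P.1 + ψ)) = P.1 - intPart (h * P.1) := by
  have hh : h ∈ tail F 1 := (mem_tail_iff_order h0).2 ho.ge
  have : intPart (h * ψ) = 0 :=
    intPart_eq_zero_iff.2 (tail_anti (by omega) (mul_mem_tail hh hψ))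
  rw [sub_mul, one_mul, intPart_sub, intPart_add_of_mem_tail P hψ, mul_add, intPart_add, this,
    add_zero]

theorem fareyMap_branch (h0 : h ≠ 0) (ho : h.order = 1) (P : Poly F) (hP : P.1.order ≤ -1)
    {ψ : F⸨X⸩} (hψ : ψ ∈ tail F 1) :
    fareyMap h (branch P ψ) = branch (P.shift h0 ho hP) ψ := by
  have hg := (add_of_mem_tail P hψ).1
  have hd : deg (branch P ψ) ≤ ((-1 : ℤ) : WithBot ℤ) := by
    rw [deg_le_coe_iff]
    exact tail_anti (by omega) (branch_mem_tail P hψ)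
  have hs := (add_of_mem_tail (P.shift h0 ho hP) hψ).1
  rw [fareyMap, if_pos hd]
  simp only [branch, inv_inv]
  rw [intPart_one_sub_mul h0 ho P hψ]
  have e : (P.shift h0 ho hP).1 = intPart (h * P.1) := rfl
  rw [e] at hs ⊢
  have e2 : 1 - (P.1 - intPart (h * P.1)) * (P.1 + ψ)⁻¹ =
      (intPart (h * P.1) + ψ) * (P.1 + ψ)⁻¹ := by field_simp; ring
  rw [e2]
  field_simp

theorem fareyMap_branch_of_order_eq_zero (h0 : h ≠ 0) (ho : h.order = 1) (P : Poly F)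
    (hP : P.1.order = 0) {ψ : F⸨X⸩} (hψ : ψ ∈ tail F 1) : fareyMap h (branch P ψ) = ψ := by
  have hg := (add_of_mem_tail P hψ).1
  have hd : ¬ deg (branch P ψ) ≤ ((-1 : ℤ) : WithBot ℤ) := by
    rw [deg_le_coe_iff, mem_tail_iff_order (branch_ne_zero P hψ), order_branch P hψ]
    omega
  have hz : intPart (h * P.1) = 0 := by
    rw [intPart_eq_zero_iff, mem_tail_iff_order (mul_ne_zero h0 P.2.2),
      HahnSeries.order_mul h0 P.2.2]
    omega
  rw [fareyMap, if_neg hd]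
  simp only [branch, inv_inv]
  rw [intPart_one_sub_mul h0 ho P hψ, hz]
  field_simp
  ring

theorem fareyMap_zero (h : F⸨X⸩) : fareyMap h 0 = 0 := by simp [fareyMap]

theorem mapsTo_fareyMap (h0 : h ≠ 0) (ho : h.order = 1) :
    Set.MapsTo (fareyMap h) (integers F) (integers F) := by
  rw [integers_eq_tail]
  intro f hf
  by_cases hf0 : f = 0
  · simp [hf0, fareyMap_zero, zero_mem]
  obtain ⟨P, hP⟩ := exists_mem_cell_iff.2 ⟨hf0, hf⟩
  obtain ⟨ψ, hψ, rfl⟩ := exists_branch_eq_of_mem_cell hP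
  rcases P.order_nonpos.eq_or_lt with hn | hn
  · rw [fareyMap_branch_of_order_eq_zero h0 ho P hn hψ]
    exact tail_anti (by omega) hψ
  · rw [fareyMap_branch h0 ho P (by omega) hψ]
    exact tail_anti (by have := (P.shift h0 ho (by omega)).order_nonpos; omega)
      (branch_mem_tail _ hψ)

/-- On the cell of `P`, the Farey map needs `deg P + 1` steps to strip off the digit `P`. -/
theorem fareyMap_iterate_branch (h0 : h ≠ 0) (ho : h.order = 1) (n : ℕ) :
    ∀ (P : Poly F) (_ : P.1.order = -(n : ℤ)) {ψ : F⸨X⸩} (_ : ψ ∈ tail F 1),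
      (fareyMap h)^[n + 1] (branch P ψ) = ψ := by
  induction n with
  | zero =>
    intro P hP ψ hψ
    exact fareyMap_branch_of_order_eq_zero h0 ho P (by simpa using hP) hψ
  | succ n ih =>
    intro P hP ψ hψ
    push_cast at hP
    rw [Function.iterate_succ_apply, fareyMap_branch h0 ho P (by omega) hψ]
    exact ih _ (by rw [Poly.order_shift]; omega) hψ

theorem fareyMap_iterate_eq_artinMap (h0 : h ≠ 0) (ho : h.order = 1) {f : F⸨X⸩}
    (hf : f ∈ maxIdeal F) (hf0 : f ≠ 0) {d : ℤ} (hd : deg f = (d : WithBot ℤ)) :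
    (fareyMap h)^[(1 - d).toNat] f = artinMap f := by
  rw [maxIdeal_eq_tail] at hf
  obtain ⟨P, hP⟩ := exists_mem_cell_iff.2 ⟨hf0, tail_anti (by omega) hf⟩
  have hart : artinMap f = f⁻¹ - P.1 := by
    rw [artinMap, one_div, (hP : intPart f⁻¹ = P.1)]
  obtain ⟨ψ, hψ, rfl⟩ := exists_branch_eq_of_mem_cell hP
  have hod := (deg_eq_coe_iff.1 hd).2
  rw [order_branch P hψ] at hod
  have hn := P.order_nonpos
  rw [hart, show (1 - d).toNat = (-P.1.order).toNat + 1 by omega,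
    fareyMap_iterate_branch h0 ho _ P (by omega) hψ]
  simp [branch]

/-- A set that is invariant under the Farey map is also invariant under every inverse branch. -/
theorem branch_mem_iff_of_invariant (h0 : h ≠ 0) (ho : h.order = 1) {A : Set F⸨X⸩}
    (hA : ∀ f ∈ tail F 0, fareyMap h f ∈ A ↔ f ∈ A) (P : Poly F) {ψ : F⸨X⸩}
    (hψ : ψ ∈ tail F 1) : branch P ψ ∈ A ↔ ψ ∈ A := by
  have key : ∀ (n : ℕ) (f : F⸨X⸩), f ∈ tail F 0 → ((fareyMap h)^[n] f ∈ A ↔ f ∈ A) := by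
    intro n
    induction n with
    | zero => simp
    | succ n ih =>
      intro f hf
      have hm := mapsTo_fareyMap (F := F) h0 ho
      rw [integers_eq_tail] at hm
      rw [Function.iterate_succ_apply, ih _ (hm hf), hA f hf]
  have hn := P.order_nonpos
  rw [← key ((-P.1.order).toNat + 1) _ (tail_anti (by omega) (branch_mem_tail P hψ)),
    fareyMap_iterate_branch h0 ho _ P (by omega) hψ]

/-- Every nonzero polynomial is `[h P]` for exactly `q` polynomials `P`, all of degree at least `1`,
which are distinguished by their constant terms. -/
theorem bijective_shift_coeff (h0 : h ≠ 0) (ho : h.order = 1) :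
    Function.Bijective fun P : {P : Poly F // P.1.order ≤ -1} =>
      ((P.1.shift h0 ho P.2, P.1.1.coeff 0) : Poly F × F) := by
  have hh : h ∈ tail F 1 := (mem_tail_iff_order h0).2 ho.ge
  constructor
  · rintro ⟨⟨P, hP, hP0⟩, hn⟩ ⟨⟨Q, hQ, hQ0⟩, hm⟩ hPQ
    obtain ⟨h1, h2⟩ := Prod.ext_iff.1 hPQ
    have h1' : intPart (h * P) = intPart (h * Q) := congrArg Subtype.val h1
    have h2' : P.coeff 0 = Q.coeff 0 := h2
    have hD : P - Q = 0 := by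
      rw [← sub_eq_zero, ← intPart_sub, ← mul_sub, intPart_eq_zero_iff] at h1'
      have hD1 : P - Q ∈ tail F 1 := by
        intro n hn
        by_cases hD : P - Q = 0
        · simp [hD]
        rw [mem_tail_iff_order (mul_ne_zero h0 hD), HahnSeries.order_mul h0 hD] at h1'
        rcases (show n = 0 ∨ n < 0 by omega) with rfl | hn'
        · simp [h2']
        · exact HahnSeries.coeff_eq_zero_of_lt_order (by omega)
      rw [← intPart_eq_zero_iff, intPart_sub, hP, hQ] at hD1
      exact hD1
    have : P = Q := sub_eq_zero.1 hD
    subst this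
    rfl
  · rintro ⟨⟨Q, hQ, hQ0⟩, c⟩
    have hQn : Q.order ≤ 0 := Poly.order_nonpos ⟨Q, hQ, hQ0⟩
    -- `R = [Q / h]` satisfies `[h R] = Q`; its constant term is then corrected freely.
    set R := intPart (h⁻¹ * Q) with hR
    have hor : (h⁻¹ * Q).order = Q.order - 1 := by
      rw [HahnSeries.order_mul (inv_ne_zero h0) hQ0, order_inv h0, ho]
      omega
    have hR0 : R ≠ 0 := by
      rw [Ne, hR, intPart_eq_zero_iff, mem_tail_iff_order (mul_ne_zero (inv_ne_zero h0) hQ0)]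
      omega
    have hRo : R.order = Q.order - 1 := (order_intPart hR0).2.1.trans hor
    set e : F⸨X⸩ := HahnSeries.single 0 (c - R.coeff 0) with he
    have hem : e ∈ tail F 0 := fun n hn => HahnSeries.coeff_single_of_ne hn.ne
    have hei : intPart e = e := by
      ext n
      rw [coeff_intPart]
      split_ifs with hn
      · rfl
      · exact (HahnSeries.coeff_single_of_ne (by omega)).symm
    obtain ⟨hP0, hPo⟩ := order_add hR0 (e := e) (tail_anti (by omega) hem)
    refine ⟨⟨⟨R + e, by rw [intPart_add, hei, hR, intPart_intPart], hP0⟩, by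
      show (R + e).order ≤ -1
      omega⟩, Prod.ext (Subtype.ext ?_) ?_⟩
    · show intPart (h * (R + e)) = Q
      rw [mul_add, intPart_add, intPart_eq_zero_iff.2
        (tail_anti (by omega) (mul_mem_tail hh hem)), add_zero, ← hQ,
        intPart_eq_intPart_iff]
      have := mul_mem_tail hh (neg_mem (sub_intPart_mem (h⁻¹ * Q)))
      rw [← hR, neg_sub, mul_sub, mul_inv_cancel_left₀ h0] at this
      exact tail_anti (by omega) this
    · show (R + e).coeff 0 = c
      simp [he]

end Farey

end Algebra

/-! ### Balls, topology and measurability -/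

section Topology

variable {F : Type*} [Field F]

/-- The ball of radius `q ^ (-m)` around `x`. -/
def ball (x : F⸨X⸩) (m : ℤ) : Set F⸨X⸩ := {f | f - x ∈ tail F m}

theorem mem_ball {x f : F⸨X⸩} {m : ℤ} : f ∈ ball x m ↔ f - x ∈ tail F m := Iff.rfl

theorem mem_ball_self (x : F⸨X⸩) (m : ℤ) : x ∈ ball x m := by simp [mem_ball, zero_mem]

theorem ball_zero (m : ℤ) : ball 0 m = (tail F m : Set F⸨X⸩) := by
  ext f
  simp [mem_ball]

theorem ball_eq_of_mem {x y : F⸨X⸩} {m : ℤ} (h : y ∈ ball x m) : ball x m = ball y m := by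
  ext f
  rw [mem_ball, mem_ball, ← sub_add_sub_cancel f y x]
  exact (tail F m).add_mem_cancel_right h

theorem isOpen_tail (m : ℤ) : IsOpen (tail F m : Set F⸨X⸩) := by
  have hs : (HahnSeries.single (-m) (1 : F) : F⸨X⸩) ≠ 0 := by simp
  have : (tail F m : Set F⸨X⸩) = (fun f => HahnSeries.single (-m) (1 : F) * f) ⁻¹' integers F := by
    ext f
    rw [Set.mem_preimage, integers_eq_tail, SetLike.mem_coe, SetLike.mem_coe]
    by_cases hf : f = 0
    · simp [hf, zero_mem]
    rw [mem_tail_iff_order hf, mem_tail_iff_order (mul_ne_zero hs hf),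
      HahnSeries.order_mul hs hf, HahnSeries.order_single one_ne_zero]
    omega
  rw [this]
  exact (isOpen_integers F).preimage (continuous_const.mul continuous_id)

theorem isOpen_ball (x : F⸨X⸩) (m : ℤ) : IsOpen (ball x m) :=
  (isOpen_tail m).preimage (continuous_id.sub continuous_const)

theorem exists_ball_subset {x : F⸨X⸩} {U : Set F⸨X⸩} (hU : U ∈ nhds x) :
    ∃ m : ℤ, ball x m ⊆ U := by
  obtain ⟨γ, hγ⟩ := Valued.mem_nhds.mp hU
  set g : WithZero (Multiplicative ℤ) := MonoidWithZeroHom.ValueGroup₀.embedding γ.1 with hg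
  have hg0 : g ≠ 0 := by simp [hg]
  have hD : WithZero.exp (-(-(WithZero.log g - 1))) < g := by
    rw [← WithZero.lt_log_iff_exp_lt hg0]
    simp
  refine ⟨-(WithZero.log g - 1), fun y hy => hγ ?_⟩
  show Valued.v.restrict (y - x) < γ.1
  rw [Valued.v.restrict_lt_iff_lt_embedding]
  exact lt_of_le_of_lt ((LaurentSeries.valuation_le_iff_coeff_lt_eq_zero F).mpr hy) hD

variable (F) in
/-- The collection of all balls of `F⸨X⸩`. -/
def balls : Set (Set F⸨X⸩) := {s | ∃ x m, s = ball x m}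

theorem isTopologicalBasis_balls : TopologicalSpace.IsTopologicalBasis (balls F) := by
  refine TopologicalSpace.isTopologicalBasis_of_isOpen_of_nhds ?_ ?_
  · rintro _ ⟨x, m, rfl⟩
    exact isOpen_ball x m
  · intro x U hx hU
    obtain ⟨m, hm⟩ := exists_ball_subset (hU.mem_nhds hx)
    exact ⟨_, ⟨x, m, rfl⟩, mem_ball_self x m, hm⟩

theorem isPiSystem_balls : IsPiSystem (balls F) := by
  rintro _ ⟨x, m, rfl⟩ _ ⟨y, n, rfl⟩ ⟨z, hzx, hzy⟩
  rw [ball_eq_of_mem hzx, ball_eq_of_mem hzy]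
  rcases le_total m n with h | h
  · have hs : ball z n ⊆ ball z m := fun f hf => tail_anti h hf
    rw [Set.inter_eq_right.2 hs]
    exact ⟨z, n, rfl⟩
  · have hs : ball z m ⊆ ball z n := fun f hf => tail_anti h hf
    rw [Set.inter_eq_left.2 hs]
    exact ⟨z, m, rfl⟩

theorem countable_range_truncLT [Finite F] (m : ℤ) :
    (Set.range (HahnSeries.truncLT m : F⸨X⸩ → F⸨X⸩)).Countable := by
  have hfin : ∀ f : F⸨X⸩, (HahnSeries.truncLT m f).support.Finite := by
    intro f
    refine (Set.finite_Ico f.order m).subset fun n hn => ?_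
    rw [HahnSeries.support_truncLT] at hn
    exact ⟨HahnSeries.order_le_of_coeff_ne_zero hn.1, hn.2⟩
  have : Set.range (HahnSeries.truncLT m : F⸨X⸩ → F⸨X⸩) ⊆
      Set.range fun a : ℤ →₀ F => HahnSeries.truncLT m (HahnSeries.ofFinsupp a) := by
    rintro _ ⟨f, rfl⟩
    refine ⟨Finsupp.ofSupportFinite _ (hfin f), ?_⟩
    ext n
    show (if n < m then (if n < m then f.coeff n else 0) else 0) = if n < m then f.coeff n else 0
    split_ifs <;> rfl
  exact (Set.countable_range _).mono this

instance [Finite F] : Countable (Poly F) := by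
  have : Countable (Set.range (HahnSeries.truncLT 1 : F⸨X⸩ → F⸨X⸩)) :=
    (countable_range_truncLT 1).to_subtype
  refine Function.Injective.countable
    (f := fun P : Poly F => (⟨P.1, P.1, P.2.1⟩ : Set.range (HahnSeries.truncLT 1 : F⸨X⸩ → F⸨X⸩)))
    fun P Q hPQ => Subtype.ext (congrArg (fun R => R.1) hPQ)

theorem countable_balls [Finite F] : (balls F).Countable := by
  have : balls F ⊆ ⋃ m : ℤ, (fun x => ball x m) '' Set.range (HahnSeries.truncLT m) := by
    rintro _ ⟨x, m, rfl⟩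
    refine Set.mem_iUnion.2 ⟨m, _, ⟨x, rfl⟩, (ball_eq_of_mem ?_).symm⟩
    intro n hn
    rw [HahnSeries.coeff_sub, HahnSeries.coeff_truncLT, if_pos hn, sub_self]
  exact (Set.countable_iUnion fun m => (countable_range_truncLT m).image _).mono this

instance [Finite F] : SecondCountableTopology F⸨X⸩ :=
  isTopologicalBasis_balls.secondCountableTopology countable_balls

theorem measurableSet_tail (m : ℤ) : MeasurableSet (tail F m : Set F⸨X⸩) :=
  (isOpen_tail m).measurableSet

theorem measurableSet_integers : MeasurableSet (integers F) := (isOpen_integers F).measurableSet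

theorem continuous_intPart : Continuous (intPart : F⸨X⸩ → F⸨X⸩) := by
  rw [continuous_iff_continuousAt]
  intro x
  have : intPart =ᶠ[nhds x] fun _ => intPart x := by
    filter_upwards [(isOpen_ball x 1).mem_nhds (mem_ball_self x 1)] with y hy
    exact intPart_eq_intPart_iff.2 hy
  exact continuousAt_const.congr this.symm

theorem measurable_branch [Finite F] (P : Poly F) : Measurable (branch P) :=
  measurable_inv.comp (measurable_const.add measurable_id)

theorem measurableSet_cell [Finite F] (P : Poly F) : MeasurableSet (cell P) :=
  (continuous_intPart.measurable.comp measurable_inv) (measurableSet_singleton P.1)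

theorem measurable_fareyMap [Finite F] (h : F⸨X⸩) : Measurable (fareyMap h) := by
  have hd : Measurable fun f : F⸨X⸩ => 1 - intPart ((1 - h) * f⁻¹) * f :=
    measurable_const.sub ((continuous_intPart.measurable.comp
      (measurable_inv.const_mul _)).mul measurable_id)
  have hs : MeasurableSet {f : F⸨X⸩ | deg f ≤ ((-1 : ℤ) : WithBot ℤ)} := by
    simp_rw [deg_le_coe_iff]
    exact measurableSet_tail _
  exact Measurable.ite hs (measurable_id.div hd) (hd.div measurable_id)

/-- Measures that are finite on balls are determined by their values on balls. -/
theorem ext_of_balls [Finite F] {μ ν : Measure F⸨X⸩} (hfin : ∀ m, μ (tail F m) ≠ ∞)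
    (h : ∀ x m, μ (ball x m) = ν (ball x m)) : μ = ν := by
  refine Measure.ext_of_generateFrom_of_iUnion (balls F) (fun n => tail F (-n))
    isTopologicalBasis_balls.borel_eq_generateFrom isPiSystem_balls ?_ ?_ ?_ ?_
  · refine Set.eq_univ_of_forall fun f => Set.mem_iUnion.2 ⟨(-f.order).toNat, fun n hn => ?_⟩
    exact HahnSeries.coeff_eq_zero_of_lt_order (by omega)
  · exact fun n => ⟨0, _, (ball_zero _).symm⟩
  · exact fun n => hfin _
  · rintro _ ⟨x, m, rfl⟩
    exact h x m

end Topology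

/-! ### Haar measure of balls and of the inverse branches -/

section Haar

variable {F : Type*} [Field F] [Finite F]

instance : (haar F).IsAddHaarMeasure := by
  unfold haar
  infer_instance

theorem haar_tail_zero : haar F (tail F 0) = 1 := by
  rw [← integers_eq_tail]
  exact Measure.addHaarMeasure_self (K₀ := compactIntegers F)

theorem haar_ball (x : F⸨X⸩) (m : ℤ) : haar F (ball x m) = haar F (tail F m) := by
  have : ball x m = (fun f => f + -x) ⁻¹' (tail F m : Set F⸨X⸩) := by
    ext f
    simp [mem_ball, sub_eq_add_neg]
  rw [this, measure_preimage_add_right]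

theorem haar_tail_succ (m : ℤ) :
    haar F (tail F m) = Nat.card F * haar F (tail F (m + 1)) := by
  have hU : (tail F m : Set F⸨X⸩) = ⋃ c : F, ball (HahnSeries.single m c) (m + 1) := by
    ext f
    rw [Set.mem_iUnion]
    constructor
    · intro hf
      refine ⟨f.coeff m, fun n hn => ?_⟩
      rw [HahnSeries.coeff_sub, HahnSeries.coeff_single]
      split_ifs with h
      · rw [h, sub_self]
      · rw [hf n (by omega), sub_zero]
    · rintro ⟨c, hc⟩ n hn
      have := hc n (by omega)
      rwa [HahnSeries.coeff_sub, HahnSeries.coeff_single_of_ne hn.ne, sub_zero] at this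
  have hd : Pairwise (Function.onFun Disjoint
      fun c : F => ball (HahnSeries.single m c : F⸨X⸩) (m + 1)) := by
    intro c d hcd
    refine Set.disjoint_left.2 fun f hc hd => hcd ?_
    have h1 := hc m (by omega)
    have h2 := hd m (by omega)
    rw [HahnSeries.coeff_sub, HahnSeries.coeff_single_same, sub_eq_zero] at h1 h2
    exact h1.symm.trans h2
  rw [hU, measure_iUnion hd fun c => (isOpen_ball _ _).measurableSet]
  simp_rw [haar_ball, ENNReal.tsum_const, ENat.card_eq_coe_natCard]
  simp

theorem card_ne_zero : (Nat.card F : ℝ≥0∞) ≠ 0 := by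
  simpa using (Nat.card_pos (α := F)).ne'

theorem haar_tail (m : ℤ) : haar F (tail F m) = (Nat.card F : ℝ≥0∞) ^ (-m) := by
  induction m using Int.induction_on with
  | zero => simp [haar_tail_zero]
  | succ n ih =>
    rw [haar_tail_succ] at ih
    rw [neg_add, ENNReal.zpow_add card_ne_zero (ENNReal.natCast_ne_top _), ← ih, zpow_neg_one,
      mul_right_comm, ENNReal.mul_inv_cancel card_ne_zero (ENNReal.natCast_ne_top _), one_mul]
  | pred n ih =>
    rw [haar_tail_succ, sub_add_cancel, ih, neg_sub, sub_eq_add_neg,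
      ENNReal.zpow_add card_ne_zero (ENNReal.natCast_ne_top _), zpow_one]

variable (F) in
/-- The Haar measure restricted to `𝕃`. -/
noncomputable def haarL : Measure F⸨X⸩ := (haar F).restrict (tail F 1)

theorem haarL_univ : haarL F Set.univ = (Nat.card F : ℝ≥0∞)⁻¹ := by
  rw [haarL, Measure.restrict_apply_univ, haar_tail, zpow_neg_one]

instance : IsFiniteMeasure (haarL F) :=
  ⟨by rw [haarL_univ]; exact ENNReal.inv_lt_top.2 (pos_iff_ne_zero.2 card_ne_zero)⟩

theorem haarL_congr {A B : Set F⸨X⸩} (h : ∀ ψ ∈ tail F 1, ψ ∈ A ↔ ψ ∈ B) :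
    haarL F A = haarL F B := by
  refine measure_congr ?_
  rw [haarL]
  filter_upwards [self_mem_ae_restrict (measurableSet_tail 1)] with ψ hψ
  exact propext (h ψ hψ)

/-- The Jacobian of the branch of `P` is the constant `q ^ (-2 deg P)`. -/
theorem haar_restrict_cell (P : Poly F) :
    (haar F).restrict (cell P) =
      (Nat.card F : ℝ≥0∞) ^ (2 * P.1.order) • (haarL F).map (branch P) := by
  refine ext_of_balls (fun m => ?_) fun x m => ?_
  · refine ne_top_of_le_ne_top ?_ (Measure.restrict_apply_le _ _)
    rw [haar_tail]
    exact ENNReal.zpow_ne_top card_ne_zero (ENNReal.natCast_ne_top _) _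
  rw [Measure.restrict_apply (isOpen_ball x m).measurableSet, Measure.smul_apply,
    Measure.map_apply (measurable_branch P) (isOpen_ball x m).measurableSet, smul_eq_mul]
  by_cases hne : (ball x m ∩ cell P).Nonempty
  · obtain ⟨f, hfx, hfP⟩ := hne
    obtain ⟨φ, hφ, rfl⟩ := exists_branch_eq_of_mem_cell hfP
    have h1 : ball x m ∩ cell P = ball (branch P φ) (max m (1 - 2 * P.1.order)) := by
      rw [ball_eq_of_mem hfx]
      ext f
      rw [Set.mem_inter_iff, mem_cell_iff P hφ, mem_ball, mem_ball]
      exact ⟨fun h n hn => (lt_max_iff.1 hn).elim (h.1 n) (h.2 n),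
        fun h => ⟨tail_anti (le_max_left _ _) h, tail_anti (le_max_right _ _) h⟩⟩
    have h2 : branch P ⁻¹' ball x m ∩ tail F 1 = ball φ (max (m + 2 * P.1.order) 1) := by
      rw [ball_eq_of_mem hfx]
      ext ψ
      rw [Set.mem_inter_iff, Set.mem_preimage, mem_ball, mem_ball]
      constructor
      · rintro ⟨h, hψ⟩
        rw [branch_sub_branch_mem_tail_iff P hψ hφ] at h
        exact fun n hn => (lt_max_iff.1 hn).elim (h n) (sub_mem hψ hφ n)
      · intro h
        have hψ : ψ ∈ tail F 1 := by
          rw [← sub_add_cancel ψ φ]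
          exact add_mem (tail_anti (le_max_right _ _) h) hφ
        exact ⟨(branch_sub_branch_mem_tail_iff P hψ hφ).2 (tail_anti (le_max_left _ _) h), hψ⟩
    rw [haarL, Measure.restrict_apply (measurable_branch P (isOpen_ball x m).measurableSet),
      h1, h2, haar_ball, haar_ball, haar_tail, haar_tail,
      ← ENNReal.zpow_add card_ne_zero (ENNReal.natCast_ne_top _)]
    congr 1
    omega
  · have h0 : haarL F (branch P ⁻¹' ball x m) = haarL F ∅ :=
      haarL_congr fun ψ hψ => ⟨fun h => hne ⟨_, h, branch_mem_cell P hψ⟩, fun h => h.elim⟩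
    rw [h0, Set.not_nonempty_iff_eq_empty.1 hne]
    simp

theorem haar_inter_cell (P : Poly F) {A : Set F⸨X⸩} (hA : MeasurableSet A) :
    haar F (A ∩ cell P) =
      (Nat.card F : ℝ≥0∞) ^ (2 * P.1.order) * haarL F (branch P ⁻¹' A) := by
  have := congrArg (fun μ => μ A) (haar_restrict_cell P)
  rwa [Measure.restrict_apply hA, Measure.smul_apply, smul_eq_mul,
    Measure.map_apply (measurable_branch P) hA] at this

theorem one_lt_card : 1 < (Nat.card F : ℝ≥0∞) := by
  exact_mod_cast Finite.one_lt_card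

theorem haar_singleton_zero : haar F {0} = 0 := by
  have hlt : (Nat.card F : ℝ≥0∞)⁻¹ < 1 := ENNReal.inv_lt_one.2 one_lt_card
  refine le_antisymm (ge_of_tendsto' (ENNReal.tendsto_pow_atTop_nhds_zero_of_lt_one hlt)
    fun n => ?_) bot_le
  refine (measure_mono (t := tail F n) (by simp [zero_mem])).trans_eq ?_
  rw [haar_tail, ENNReal.zpow_neg, zpow_natCast, ENNReal.inv_pow]

/-- Up to the null point `0`, a union of cells is the disjoint union of its cells. -/
theorem haar_inter_eq_tsum {S : Set F⸨X⸩} {p : Poly F → Prop}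
    (hS : ∀ f, f ≠ 0 → (f ∈ S ↔ ∃ P : Poly F, p P ∧ f ∈ cell P)) {A : Set F⸨X⸩}
    (hA : MeasurableSet A) :
    haar F (A ∩ S) = ∑' P : {P : Poly F // p P},
      (Nat.card F : ℝ≥0∞) ^ (2 * P.1.1.order) * haarL F (branch P.1 ⁻¹' A) := by
  simp_rw [← haar_inter_cell _ hA]
  rw [← measure_iUnion]
  · refine measure_congr ?_
    have : ∀ᵐ f ∂(haar F), f ≠ 0 := by
      rw [ae_iff]
      simpa using haar_singleton_zero (F := F)
    filter_upwards [this] with f hf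
    refine propext ?_
    show f ∈ A ∩ S ↔ f ∈ ⋃ P : {P : Poly F // p P}, A ∩ cell P.1
    rw [Set.mem_inter_iff, hS f hf, Set.mem_iUnion]
    constructor
    · rintro ⟨h1, P, h2, h3⟩
      exact ⟨⟨P, h2⟩, h1, h3⟩
    · rintro ⟨⟨P, h2⟩, h1, h3⟩
      exact ⟨h1, P, h2, h3⟩
  · intro P Q hPQ
    refine Set.disjoint_left.2 fun f hP hQ => hPQ (Subtype.ext (Subtype.ext ?_))
    exact (hP.2 : intPart f⁻¹ = P.1.1).symm.trans hQ.2
  · exact fun P => hA.inter (measurableSet_cell P.1)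

end Haar

/-! ### Transport of the Haar measure by the Farey map -/

section Transport

variable {F : Type*} [Field F] [Finite F]

variable (F) in
/-- The Haar measure restricted to `𝕁₀`. -/
noncomputable def haarJ : Measure F⸨X⸩ := (haar F).restrict (sphere F 0)

theorem haarL_apply_eq_tsum {A : Set F⸨X⸩} (hA : MeasurableSet A) :
    haarL F A = ∑' P : {P : Poly F // P.1.order ≤ -1},
      (Nat.card F : ℝ≥0∞) ^ (2 * P.1.1.order) * haarL F (branch P.1 ⁻¹' A) := by
  rw [haarL, Measure.restrict_apply hA]
  refine haar_inter_eq_tsum (fun f hf => ?_) hA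
  rw [SetLike.mem_coe, mem_tail_iff_order hf]
  constructor
  · intro h1
    obtain ⟨P, hP⟩ := exists_mem_cell_iff.2 ⟨hf, (mem_tail_iff_order hf).2 (by omega)⟩
    refine ⟨P, ?_, hP⟩
    obtain ⟨ψ, hψ, rfl⟩ := exists_branch_eq_of_mem_cell hP
    rw [order_branch P hψ] at h1
    omega
  · rintro ⟨P, h1, hP⟩
    obtain ⟨ψ, hψ, rfl⟩ := exists_branch_eq_of_mem_cell hP
    rw [order_branch P hψ]
    omega

theorem haarJ_apply_eq_tsum {A : Set F⸨X⸩} (hA : MeasurableSet A) :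
    haarJ F A = ∑' P : {P : Poly F // P.1.order = 0}, haarL F (branch P.1 ⁻¹' A) := by
  rw [haarJ, Measure.restrict_apply hA, haar_inter_eq_tsum (p := fun P => P.1.order = 0) _ hA]
  · refine tsum_congr fun P => ?_
    rw [P.2, mul_zero, zpow_zero, one_mul]
  · intro f hf
    rw [mem_sphere_zero_iff]
    constructor
    · rintro ⟨-, h1⟩
      obtain ⟨P, hP⟩ := exists_mem_cell_iff.2 ⟨hf, (mem_tail_iff_order hf).2 h1.ge⟩
      refine ⟨P, ?_, hP⟩
      obtain ⟨ψ, hψ, rfl⟩ := exists_branch_eq_of_mem_cell hP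
      rw [order_branch P hψ] at h1
      omega
    · rintro ⟨P, h1, hP⟩
      obtain ⟨ψ, hψ, rfl⟩ := exists_branch_eq_of_mem_cell hP
      exact ⟨branch_ne_zero P hψ, by rw [order_branch P hψ]; omega⟩

omit [Finite F] in
theorem measurableSet_sphere_zero : MeasurableSet (sphere F 0) := by
  have : sphere F 0 = (tail F 0 : Set F⸨X⸩) \ tail F 1 := by
    ext f
    rw [mem_sphere_zero_iff, Set.mem_sdiff, SetLike.mem_coe, SetLike.mem_coe]
    by_cases hf : f = 0
    · simp [hf, zero_mem]
    · rw [mem_tail_iff_order hf, mem_tail_iff_order hf]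
      simp only [ne_eq, hf, not_false_eq_true, true_and]
      omega
  rw [this]
  exact (measurableSet_tail 0).diff (measurableSet_tail 1)

theorem haarL_add_haarJ : haarL F + haarJ F = (haar F).restrict (tail F 0) := by
  have hd : Disjoint (tail F 1 : Set F⸨X⸩) (sphere F 0) := by
    refine Set.disjoint_left.2 fun f h1 h2 => ?_
    rw [mem_sphere_zero_iff] at h2
    rw [SetLike.mem_coe, mem_tail_iff_order h2.1] at h1
    omega
  rw [haarL, haarJ, ← Measure.restrict_union hd measurableSet_sphere_zero]
  congr 1
  ext f
  rw [Set.mem_union, mem_sphere_zero_iff, SetLike.mem_coe, SetLike.mem_coe]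
  by_cases hf : f = 0
  · simp [hf, zero_mem]
  · rw [mem_tail_iff_order hf, mem_tail_iff_order hf]
    simp only [ne_eq, hf, not_false_eq_true, true_and]
    omega

theorem haarL_add_haarJ_apply_eq_tsum {A : Set F⸨X⸩} (hA : MeasurableSet A) :
    haarL F A + haarJ F A = ∑' P : Poly F,
      (Nat.card F : ℝ≥0∞) ^ (2 * P.1.order) * haarL F (branch P ⁻¹' A) := by
  rw [← Measure.add_apply, haarL_add_haarJ, Measure.restrict_apply hA,
    haar_inter_eq_tsum (p := fun _ => True) _ hA]
  · exact (Equiv.subtypeUnivEquiv fun _ => trivial).tsum_eq (fun P : Poly F =>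
      (Nat.card F : ℝ≥0∞) ^ (2 * P.1.order) * haarL F (branch P ⁻¹' A))
  · intro f hf
    simp only [true_and]
    rw [exists_mem_cell_iff]
    simp [hf]

variable (F) in
/-- The number `q - 1` of nonzero constant polynomials. It is also the mass of `𝕁₀` relative to
`𝕃`, from which its value is derived in `one_add_numConst`. -/
noncomputable def numConst : ℝ≥0∞ := ∑' _ : {P : Poly F // P.1.order = 0}, 1

theorem haarJ_univ : haarJ F Set.univ = numConst F * (Nat.card F : ℝ≥0∞)⁻¹ := by
  rw [haarJ_apply_eq_tsum MeasurableSet.univ, numConst, ← ENNReal.tsum_mul_right]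
  simp [haarL_univ]

theorem one_add_numConst : 1 + numConst F = Nat.card F := by
  have h : haarL F Set.univ + haarJ F Set.univ = 1 := by
    rw [← Measure.add_apply, haarL_add_haarJ, Measure.restrict_apply_univ, haar_tail_zero]
  rw [haarL_univ, haarJ_univ] at h
  have hc := ENNReal.inv_mul_cancel (card_ne_zero (F := F)) (ENNReal.natCast_ne_top _)
  calc 1 + numConst F = (((Nat.card F : ℝ≥0∞)⁻¹ + numConst F * (Nat.card F : ℝ≥0∞)⁻¹)) *
      Nat.card F := by rw [add_mul, mul_assoc, hc, mul_one]
    _ = Nat.card F := by rw [h, one_mul]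

variable {h : F⸨X⸩}

/-- The Farey map spreads the Haar measure of `𝕃` evenly over `𝒪`. -/
theorem haarL_preimage_fareyMap (h0 : h ≠ 0) (ho : h.order = 1) {A : Set F⸨X⸩}
    (hA : MeasurableSet A) :
    haarL F (fareyMap h ⁻¹' A) = (Nat.card F : ℝ≥0∞)⁻¹ * (haarL F A + haarJ F A) := by
  have hq := card_ne_zero (F := F)
  rw [haarL_apply_eq_tsum (measurable_fareyMap h hA), haarL_add_haarJ_apply_eq_tsum hA]
  let e := Equiv.ofBijective _ (bijective_shift_coeff h0 ho)
  have : ∀ P : {P : Poly F // P.1.order ≤ -1},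
      (Nat.card F : ℝ≥0∞) ^ (2 * P.1.1.order) * haarL F (branch P.1 ⁻¹' (fareyMap h ⁻¹' A)) =
        (fun x : Poly F × F => (Nat.card F : ℝ≥0∞) ^ (2 * x.1.1.order - 2) *
          haarL F (branch x.1 ⁻¹' A)) (e P) := by
    intro P
    show _ = (Nat.card F : ℝ≥0∞) ^ (2 * (P.1.shift h0 ho P.2).1.order - 2) *
          haarL F (branch (P.1.shift h0 ho P.2) ⁻¹' A)
    rw [Poly.order_shift, show 2 * (P.1.1.order + 1) - 2 = 2 * P.1.1.order by ring]
    congr 1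
    refine haarL_congr fun ψ hψ => ?_
    rw [Set.mem_preimage, Set.mem_preimage, fareyMap_branch h0 ho P.1 P.2 hψ, Set.mem_preimage]
  rw [tsum_congr this, e.tsum_eq (fun x : Poly F × F =>
    (Nat.card F : ℝ≥0∞) ^ (2 * x.1.1.order - 2) * haarL F (branch x.1 ⁻¹' A)),
    ENNReal.tsum_prod (f := fun (P : Poly F) (_ : F) =>
      (Nat.card F : ℝ≥0∞) ^ (2 * P.1.order - 2) * haarL F (branch P ⁻¹' A)),
    ← ENNReal.tsum_mul_left]
  refine tsum_congr fun P => ?_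
  have hz : (Nat.card F : ℝ≥0∞) * (Nat.card F : ℝ≥0∞) ^ (2 * P.1.order - 2) =
      (Nat.card F : ℝ≥0∞)⁻¹ * (Nat.card F : ℝ≥0∞) ^ (2 * P.1.order) := by
    rw [← zpow_neg_one, ← ENNReal.zpow_add hq (ENNReal.natCast_ne_top _)]
    nth_rewrite 1 [← zpow_one (Nat.card F : ℝ≥0∞)]
    rw [← ENNReal.zpow_add hq (ENNReal.natCast_ne_top _)]
    congr 1
    ring
  rw [ENNReal.tsum_const, ENat.card_eq_coe_natCard, ← mul_assoc, ← mul_assoc, ← hz]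
  simp

/-- On each cell inside `𝕁₀` the Farey map is the inverse of a measure preserving branch. -/
theorem haarJ_preimage_fareyMap (h0 : h ≠ 0) (ho : h.order = 1) {A : Set F⸨X⸩}
    (hA : MeasurableSet A) : haarJ F (fareyMap h ⁻¹' A) = numConst F * haarL F A := by
  rw [haarJ_apply_eq_tsum (measurable_fareyMap h hA), numConst, ← ENNReal.tsum_mul_right]
  refine tsum_congr fun P => ?_
  rw [one_mul]
  refine haarL_congr fun ψ hψ => ?_
  rw [Set.mem_preimage, Set.mem_preimage, fareyMap_branch_of_order_eq_zero h0 ho P.1 P.2 hψ]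

end Transport

/-! ### Stationary measures of the Artin branches -/

section Stationary

variable {F : Type*} [Field F] [Finite F]

/-- A measure on `𝕃` that is stationary under choosing the branch of a nonconstant polynomial `P`
with probability `q ^ (-2 deg P)`. -/
structure IsStationary (ν : Measure F⸨X⸩) : Prop where
  measure_compl : ν (tail F 1 : Set F⸨X⸩)ᶜ = 0
  apply_eq_tsum : ∀ A, MeasurableSet A → ν A = ∑' P : {P : Poly F // P.1.order ≤ -1},
      (Nat.card F : ℝ≥0∞) ^ (2 * P.1.1.order) * ν (branch P.1 ⁻¹' A)

theorem isStationary_haarL : IsStationary (haarL F) where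
  measure_compl := by
    rw [haarL, Measure.restrict_apply (measurableSet_tail 1).compl, Set.compl_inter_self,
      measure_empty]
  apply_eq_tsum _ hA := haarL_apply_eq_tsum hA

/-- The branches contract by a factor `q ^ 2` or more, so that the preimage of a set which is a
union of balls of radius `q ^ (-n - 1)` is one of balls of a larger radius; after `n` steps only
the total mass matters. -/
theorem IsStationary.apply_mul_univ {ν₁ ν₂ : Measure F⸨X⸩} (h₁ : IsStationary ν₁)
    (h₂ : IsStationary ν₂) (n : ℕ) : ∀ (A : Set F⸨X⸩), MeasurableSet A →
      (∀ x ∈ tail F 1, ∀ y ∈ tail F 1, x - y ∈ tail F (n + 1) → x ∈ A → y ∈ A) →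
      ν₁ A * ν₂ Set.univ = ν₂ A * ν₁ Set.univ := by
  induction n with
  | zero =>
    intro A _ h
    by_cases hA : ∃ x ∈ tail F 1, x ∈ A
    · obtain ⟨x, hx, hxA⟩ := hA
      have hsub : Aᶜ ⊆ (tail F 1 : Set F⸨X⸩)ᶜ := fun y hyA hy =>
        hyA (h x hx y hy (by simpa using sub_mem hx hy) hxA)
      have huniv : ∀ ν : Measure F⸨X⸩, IsStationary ν → ν A = ν Set.univ := fun ν hν =>
        measure_congr (ae_eq_univ.2 (measure_mono_null hsub hν.measure_compl))
      rw [huniv _ h₁, huniv _ h₂, mul_comm]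
    · have hsub : A ⊆ (tail F 1 : Set F⸨X⸩)ᶜ := fun y hyA hy => hA ⟨y, hy, hyA⟩
      rw [measure_mono_null hsub h₁.measure_compl, measure_mono_null hsub h₂.measure_compl,
        zero_mul, zero_mul]
  | succ n ih =>
    intro A hA h
    rw [h₁.apply_eq_tsum A hA, h₂.apply_eq_tsum A hA, ← ENNReal.tsum_mul_right,
      ← ENNReal.tsum_mul_right]
    refine tsum_congr fun P => ?_
    rw [mul_assoc, mul_assoc, ih _ (measurable_branch P.1 hA)]
    intro x hx y hy hxy hxA
    have hm : ∀ ψ ∈ tail F 1, branch P.1 ψ ∈ tail F 1 := fun ψ hψ =>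
      tail_anti (by have := P.2; omega) (branch_mem_tail P.1 hψ)
    refine h _ (hm x hx) _ (hm y hy) ?_ hxA
    rw [branch_sub_branch_mem_tail_iff P.1 hx hy]
    exact tail_anti (by have := P.2; push_cast; omega) hxy

/-- Finite stationary measures are unique up to scaling. -/
theorem IsStationary.smul_eq_smul {ν₁ ν₂ : Measure F⸨X⸩} [IsFiniteMeasure ν₁]
    [IsFiniteMeasure ν₂] (h₁ : IsStationary ν₁) (h₂ : IsStationary ν₂) :
    ν₂ Set.univ • ν₁ = ν₁ Set.univ • ν₂ := by
  refine ext_of_balls (fun m => ?_) fun x m => ?_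
  · rw [Measure.smul_apply, smul_eq_mul]
    exact ENNReal.mul_ne_top (measure_ne_top _ _) (measure_ne_top _ _)
  · rw [Measure.smul_apply, Measure.smul_apply, smul_eq_mul, smul_eq_mul,
      mul_comm (ν₂ Set.univ), mul_comm (ν₁ Set.univ)]
    refine h₁.apply_mul_univ h₂ m.toNat _ (isOpen_ball x m).measurableSet ?_
    intro y _ z _ hyz hy
    rw [mem_ball, show z - x = (y - x) - (y - z) by ring]
    exact sub_mem hy (tail_anti (by omega) hyz)

/-- A set invariant under all branches is null or conull in `𝕃`: restricting the Haar measure to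
it gives another stationary measure. -/
theorem haarL_eq_zero_or_compl_eq_zero {A : Set F⸨X⸩} (hA : MeasurableSet A)
    (hinv : ∀ P : Poly F, ∀ ψ ∈ tail F 1, branch P ψ ∈ A ↔ ψ ∈ A) :
    haarL F A = 0 ∨ haarL F Aᶜ = 0 := by
  have hst : IsStationary ((haarL F).restrict A) := by
    refine ⟨Measure.restrict_le_self.absolutelyContinuous isStationary_haarL.measure_compl,
      fun B hB => ?_⟩
    rw [Measure.restrict_apply hB, haarL_apply_eq_tsum (hB.inter hA)]
    refine tsum_congr fun P => ?_
    rw [Measure.restrict_apply (measurable_branch P.1 hB)]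
    congr 1
    refine haarL_congr fun ψ hψ => ?_
    rw [Set.mem_preimage, Set.mem_inter_iff, Set.mem_inter_iff, hinv P.1 ψ hψ, Set.mem_preimage]
  have := congrArg (fun μ => μ Aᶜ) (isStationary_haarL.smul_eq_smul hst)
  simp only [Measure.smul_apply, smul_eq_mul, Measure.restrict_apply_univ,
    Measure.restrict_apply hA.compl, Set.compl_inter_self, measure_empty, mul_zero] at this
  exact mul_eq_zero.1 this

theorem haarJ_eq_zero {A : Set F⸨X⸩} (hA : MeasurableSet A)
    (hinv : ∀ P : Poly F, ∀ ψ ∈ tail F 1, branch P ψ ∈ A ↔ ψ ∈ A) (h : haarL F A = 0) :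
    haarJ F A = 0 := by
  rw [haarJ_apply_eq_tsum hA, ENNReal.tsum_eq_zero]
  intro P
  rw [← h]
  exact haarL_congr fun ψ hψ => hinv P.1 ψ hψ

end Stationary

/-! ### The measure `μ_A` -/

section MuA

variable {F : Type*} [Field F] [Finite F]

variable (F) in
/-- The weight `q / (2 q - 1)` of `𝕁₀` in `μ_A`; the weight of `𝕃` is `q` times as large. -/
noncomputable def weightJ : ℝ≥0∞ :=
  ENNReal.ofReal ((Nat.card F : ℝ) / (2 * (Nat.card F : ℝ) - 1))

theorem two_le_card : (2 : ℝ) ≤ Nat.card F := by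
  exact_mod_cast (Finite.one_lt_card : 1 < Nat.card F)

theorem map_val_muA :
    (muA F).map Subtype.val = weightJ F • ((Nat.card F : ℝ≥0∞) • haarL F + haarJ F) := by
  have hq := two_le_card (F := F)
  rw [muA, (MeasurableEmbedding.subtype_coe measurableSet_integers).map_comap,
    Subtype.range_coe, Measure.restrict_add, Measure.restrict_smul, Measure.restrict_smul,
    Measure.restrict_restrict measurableSet_integers,
    Measure.restrict_restrict measurableSet_integers]
  have h1 : integers F ∩ maxIdeal F = tail F 1 := by
    rw [integers_eq_tail, maxIdeal_eq_tail]
    exact Set.inter_eq_right.2 (tail_anti (by omega))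
  have h2 : integers F ∩ sphere F 0 = sphere F 0 := Set.inter_eq_right.2 fun f hf => hf.1
  have h3 : ENNReal.ofReal ((Nat.card F : ℝ) ^ 2 / (2 * (Nat.card F : ℝ) - 1)) =
      weightJ F * Nat.card F := by
    rw [weightJ, ← ENNReal.ofReal_natCast, ← ENNReal.ofReal_mul (by
      apply div_nonneg <;> linarith)]
    congr 1
    ring
  rw [h1, h2, h3, smul_add, smul_smul]
  rfl

theorem isProbabilityMeasure_muA : IsProbabilityMeasure (muA F) := by
  have hq := two_le_card (F := F)
  constructor
  have h : muA F Set.univ = (muA F).map Subtype.val Set.univ := by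
    rw [Measure.map_apply measurable_subtype_coe MeasurableSet.univ, Set.preimage_univ]
  have hc := ENNReal.mul_inv_cancel (card_ne_zero (F := F)) (ENNReal.natCast_ne_top _)
  have hn : numConst F = ENNReal.ofReal ((Nat.card F : ℝ) - 1) := by
    rw [← ENNReal.add_right_inj ENNReal.one_ne_top, one_add_numConst, ← ENNReal.ofReal_one,
      ← ENNReal.ofReal_add zero_le_one (by linarith), ← ENNReal.ofReal_natCast]
    congr 1
    ring
  rw [h, map_val_muA, Measure.smul_apply, Measure.add_apply, Measure.smul_apply, haarL_univ,
    haarJ_univ, smul_eq_mul, smul_eq_mul, hc, hn, weightJ, ← ENNReal.ofReal_natCast,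
    ← ENNReal.ofReal_inv_of_pos (by linarith), ← ENNReal.ofReal_mul (by linarith),
    ← ENNReal.ofReal_one, ← ENNReal.ofReal_add zero_le_one (by
      apply mul_nonneg
      · linarith
      · positivity),
    ← ENNReal.ofReal_mul (by apply div_nonneg <;> linarith)]
  congr 1
  have h1 : (2 * (Nat.card F : ℝ) - 1) ≠ 0 := by linarith
  have h2 : (Nat.card F : ℝ) ≠ 0 := by linarith
  rw [div_mul_eq_mul_div, div_eq_one_iff_eq h1]
  field_simp
  ring

variable {h : F⸨X⸩}

theorem map_fareyMap_map_val_muA (h0 : h ≠ 0) (ho : h.order = 1) :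
    ((muA F).map Subtype.val).map (fareyMap h) = (muA F).map Subtype.val := by
  ext A hA
  have hc := ENNReal.mul_inv_cancel (card_ne_zero (F := F)) (ENNReal.natCast_ne_top _)
  rw [Measure.map_apply (measurable_fareyMap h) hA, map_val_muA]
  simp only [Measure.smul_apply, Measure.add_apply, smul_eq_mul]
  rw [haarL_preimage_fareyMap h0 ho hA, haarJ_preimage_fareyMap h0 ho hA, ← mul_assoc, hc,
    one_mul, ← one_add_numConst]
  ring

theorem ergodic_fareyMap (h0 : h ≠ 0) (ho : h.order = 1)
    (hO : Set.MapsTo (fareyMap h) (integers F) (integers F)) :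
    Ergodic (hO.restrict _ _ _) (muA F) := by
  have hemb := MeasurableEmbedding.subtype_coe (measurableSet_integers (F := F))
  have hmeas : Measurable (hO.restrict _ _ _) :=
    ((measurable_fareyMap h).comp measurable_subtype_coe).subtype_mk
  refine { measurable := hmeas, map_eq := ?_, aeconst_set := ?_ }
  · refine hemb.map_injective ?_
    rw [Measure.map_map measurable_subtype_coe hmeas]
    show Measure.map (fareyMap h ∘ Subtype.val) (muA F) = _
    rw [← Measure.map_map (measurable_fareyMap h) measurable_subtype_coe,
      map_fareyMap_map_val_muA h0 ho]
  · intro s hs hsinv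
    have hA : ∀ t : Set (integers F), MeasurableSet t → MeasurableSet (Subtype.val '' t) :=
      fun t ht => hemb.measurableSet_image.2 ht
    have hbranch : ∀ t : Set (integers F), (hO.restrict _ _ _) ⁻¹' t = t →
        ∀ P : Poly F, ∀ ψ ∈ tail F 1, branch P ψ ∈ Subtype.val '' t ↔ ψ ∈ Subtype.val '' t := by
      intro t htinv P ψ hψ
      refine branch_mem_iff_of_invariant h0 ho (fun f hf => ?_) P hψ
      rw [← SetLike.mem_coe, ← integers_eq_tail] at hf
      have h1 : fareyMap h f ∈ Subtype.val '' t ↔ hO.restrict _ _ _ ⟨f, hf⟩ ∈ t := by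
        constructor
        · rintro ⟨g, hg, hgf⟩
          rwa [show hO.restrict _ _ _ ⟨f, hf⟩ = g from Subtype.ext hgf.symm]
        · exact fun hg => ⟨_, hg, rfl⟩
      rw [h1, ← Set.mem_preimage, htinv]
      simp [hf]
    have hnull : ∀ t : Set (integers F), MeasurableSet t → (hO.restrict _ _ _) ⁻¹' t = t →
        haarL F (Subtype.val '' t) = 0 → muA F t = 0 := by
      intro t ht htinv h1
      have h2 := haarJ_eq_zero (hA t ht) (hbranch t htinv) h1
      rw [← Set.preimage_image_eq t Subtype.val_injective,
        ← Measure.map_apply measurable_subtype_coe (hA t ht), map_val_muA]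
      simp [h1, h2]
    rw [Filter.eventuallyConst_set]
    rcases haarL_eq_zero_or_compl_eq_zero (hA s hs) (hbranch s hsinv) with h1 | h1
    · right
      rw [ae_iff]
      simpa using hnull s hs hsinv h1
    · left
      rw [ae_iff]
      refine hnull sᶜ hs.compl (by rw [Set.preimage_compl, hsinv]) (measure_mono_null ?_ h1)
      rintro _ ⟨g, hg, rfl⟩ ⟨g', hg', hgg⟩
      exact hg (Subtype.ext hgg ▸ hg')

end MuA

end FareyMap

theorem theorem2 {F : Type*} [Field F] [Finite F] (h : LaurentSeries F)
    (hh : h ∈ FareyMap.maxIdeal F) (hdeg : FareyMap.deg h = ((-1 : ℤ) : WithBot ℤ)) :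
    (∃ hO : Set.MapsTo (FareyMap.fareyMap h) (FareyMap.integers F) (FareyMap.integers F),
      MeasureTheory.IsProbabilityMeasure (FareyMap.muA F) ∧
      Ergodic (hO.restrict _ _ _) (FareyMap.muA F)) ∧
    (∀ f ∈ FareyMap.maxIdeal F, f ≠ 0 → ∀ d : ℤ, FareyMap.deg f = (d : WithBot ℤ) →
      (FareyMap.fareyMap h)^[(1 - d).toNat] f = FareyMap.artinMap f) := by
  obtain ⟨h0, ho⟩ := FareyMap.deg_eq_coe_iff.1 hdeg
  rw [neg_neg] at ho
  exact ⟨⟨FareyMap.mapsTo_fareyMap h0 ho, FareyMap.isProbabilityMeasure_muA,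
    FareyMap.ergodic_fareyMap h0 ho _⟩,
    fun f hf hf0 d hd => FareyMap.fareyMap_iterate_eq_artinMap h0 ho hf hf0 hd⟩
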